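/- Let $\ell>0$ and let $\mu$ be a rate function on $(0,\infty)$ with $\mu(t)>0$ for Lebesgue-almost all $t>0$ and $\int_0^t\mu(s)\,ds<\infty$ for all $t$. Let $\mathcal N$ be an inhomogeneous Poisson process on $(0,\infty)$ with intensity measure $\mu(t)\,dt$ and epochs $0<T_1<T_2<\cdots$, put $T_0=0$ (and $T_{n+1}=\infty$ if there is no epoch after $T_n$), and let $$D=\min\{T_n:\ T_{n+1}-T_n\ge \ell\}$$ be the first epoch that is followed by a gap of length at least $\ell$, with $D=\infty$ if there is none. Then $\mathbb P(D>t)>0$ for all $t$, and the following hold. (a) If $\mu(t)\to m\in(0,\infty)$ as $t\to\infty$, then the equation $1=\int_0^\ell m\, e^{(\gamma-m)s}\,ds$ has a unique positive root $\gamma$, and $\mathbb P(D>t)\approx_{\log} e^{-\gamma t}$, i.e. $\dfrac{\log \mathbb P(D>t)}{-\gamma t}\to 1$ as $t\to\infty$. (b) If $\mu(t)\to\infty$ as $t\to\infty$, then $-\dfrac1t\log\mathbb P(D>t)\to 0$ as $t\to\infty$. (c) If $\mu(t)\to 0$ as $t\to\infty$, then $-\dfrac1t\log\mathbb P(D>t)\to\infty$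 as $t\to\infty$. -/

import Mathlib

open MeasureTheory ProbabilityTheory Filter Topology

noncomputable section

/-- The intensity measure `M(dt) = μ(t) dt` on `(0, ∞)`. -/
def intensity (μ : ℝ → ℝ) : Measure ℝ :=
  (volume.restrict (Set.Ioi 0)).withDensity fun t => ENNReal.ofReal (μ t)

/-- The random subset `N` of `(0, ∞)` is a Poisson point process with intensity measure `M`:
the number of points in a Borel set `B` with `M B < ∞` has the Poisson distribution with
mean `M B`, and the numbers of points in disjoint Borel sets are independent. -/
structure IsPoissonProcess {Ω : Type*} [MeasurableSpace Ω] (P : Measure Ω)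
    (N : Ω → Set ℝ) (M : Measure ℝ) : Prop where
  subset : ∀ ω, N ω ⊆ Set.Ioi 0
  measurable_count : ∀ B : Set ℝ, MeasurableSet B →
    Measurable fun ω => (N ω ∩ B).encard
  law_count : ∀ B : Set ℝ, MeasurableSet B → M B ≠ ⊤ →
    HasLaw (fun ω => (N ω ∩ B).encard)
      ((poissonMeasure (M B).toNNReal).map (Nat.cast : ℕ → ℕ∞)) P
  indep_count : ∀ (n : ℕ) (B : Fin n → Set ℝ), (∀ i, MeasurableSet (B i)) →
    Pairwise (fun i j => Disjoint (B i) (B j)) →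
      iIndepFun (fun i ω => (N ω ∩ B i).encard) P

/-- The first point of `S` after `s`; it is `∞` if there is none. -/
def nextEpoch (S : Set ℝ) (s : ℝ) : EReal :=
  sInf ((fun x : ℝ => (x : EReal)) '' {x | x ∈ S ∧ s < x})

/-- The first of the epochs `T₀ = 0, T₁, T₂, …` (the points of `{0} ∪ S`) which is followed by
a gap of size at least `ℓ`; it is `∞` if there is none. -/
def firstGap (ℓ : ℝ) (S : Set ℝ) : EReal :=
  sInf ((fun x : ℝ => (x : EReal)) ''
    {s | s ∈ insert 0 S ∧ (s : EReal) + (ℓ : EReal) ≤ nextEpoch S s})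

/-- The tail probability `ℙ(D > t)` of the first gap `D` of length `ℓ` in `N`. -/
def gapTail {Ω : Type*} [MeasurableSpace Ω] (P : Measure Ω) (N : Ω → Set ℝ) (ℓ t : ℝ) : ℝ :=
  P.real {ω | (t : EReal) < firstGap ℓ (N ω)}

/-- Logarithmic asymptotics: `log f(t) / log g(t) → 1` as `t → ∞`. -/
def LogAsymp (f g : ℝ → ℝ) : Prop :=
  Tendsto (fun t => Real.log (f t) / Real.log (g t)) atTop (𝓝 1)

/-- `γ` is a positive root of `1 = ∫₀^ℓ m e^{(γ - m) s} ds`. -/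
def IsPosRoot (ℓ m γ : ℝ) : Prop :=
  0 < γ ∧ 1 = ∫ s in (0 : ℝ)..ℓ, m * Real.exp ((γ - m) * s)

end

/-! Cut time into cells of length `δ`. The events that the cells contain a point are independent,
and a gap of length `ℓ` is, up to one cell, a run of about `ℓ / δ` empty cells. So `ℙ(D > t)` is
squeezed between survival probabilities of the chain that counts the current run of empty cells and
is killed when the run becomes too long (`failureRun_lt_of_lt_firstGap`,
`lt_firstGap_of_failureRun_lt`).

Survival is estimated by a weight `h` on run lengths that vanishes at the killing level. If one step
of the chain multiplies `h` eventually by at most (at least) `ρ`, then the survival probability is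
at most (at least) a constant times `ρ ^ n` (`exists_failureRun_le_mul_pow`,
`exists_mul_pow_le_failureRun`).

When `μ → m`, the weight `runPotential` would be exactly harmonic with factor `exp (-g δ)` if its
value at `0` were `1`. That value is a Riemann sum of `∫₀^ℓ m e^{(g - m) s} ds`, which increases
strictly in `g` and equals `1` at `γ`. Hence for small `δ` the weight gives an upper bound when `g <
γ` and a lower bound when `g > γ`. A slightly different rate `a` leaves room for the convergence of
the occupation probabilities.

When `μ → ∞` or `μ → 0`, runs killed at length `1` suffice: survival means that every cell is
occupied, and the occupation probabilities tend to `1` or to `0`. -/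

/-! ### Runs of failures in a sequence of events -/

open Classical in
/-- The number of consecutive failures of `E` immediately before `n`, frozen once it reaches
`r`. -/
noncomputable def failureRun (r : ℕ) (E : ℕ → Prop) : ℕ → ℕ
  | 0 => 0
  | n + 1 =>
    if r ≤ failureRun r E n then failureRun r E n
    else if E n then 0 else failureRun r E n + 1

lemma failureRun_succ_of_le {r : ℕ} {E : ℕ → Prop} {n : ℕ} (h : r ≤ failureRun r E n) :
    failureRun r E (n + 1) = failureRun r E n := by
  simp [failureRun, h]

lemma failureRun_succ_of_success {r : ℕ} {E : ℕ → Prop} {n : ℕ} (h : failureRun r E n < r)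
    (hE : E n) : failureRun r E (n + 1) = 0 := by
  simp [failureRun, h, hE]

lemma failureRun_succ_of_failure {r : ℕ} {E : ℕ → Prop} {n : ℕ} (h : failureRun r E n < r)
    (hE : ¬ E n) : failureRun r E (n + 1) = failureRun r E n + 1 := by
  simp [failureRun, h, hE]

lemma exists_failures_of_le_failureRun {r : ℕ} {E : ℕ → Prop} {n : ℕ}
    (h : r ≤ failureRun r E n) : ∃ i, i + r ≤ n ∧ ∀ j < r, ¬ E (i + j) := by
  -- The induction must also record that the run ends exactly at `n` while the counter is not
  -- frozen, so that the next failure extends it.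
  have key : ∀ n, ∃ i, i + failureRun r E n ≤ n ∧
      (failureRun r E n < r → i + failureRun r E n = n) ∧
      ∀ j < failureRun r E n, ¬ E (i + j) := by
    intro n
    induction n with
    | zero => exact ⟨0, by simp [failureRun]⟩
    | succ n ih =>
      obtain ⟨i, h1, h2, h3⟩ := ih
      rcases le_or_gt r (failureRun r E n) with hr | hr
      · rw [failureRun_succ_of_le hr]
        exact ⟨i, by omega, by omega, h3⟩
      · by_cases hE : E n
        · rw [failureRun_succ_of_success hr hE]
          exact ⟨n + 1, by simp⟩
        · rw [failureRun_succ_of_failure hr hE]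
          have := h2 hr
          refine ⟨i, by omega, by omega, fun j hj => ?_⟩
          rcases Nat.lt_succ_iff_lt_or_eq.mp hj with hj | rfl
          · exact h3 j hj
          · rwa [this]
  obtain ⟨i, h1, -, h3⟩ := key n
  exact ⟨i, by omega, fun j hj => h3 j (by omega)⟩

lemma le_failureRun_of_failures {r : ℕ} {E : ℕ → Prop} {n i : ℕ} (hi : i + r ≤ n)
    (h : ∀ j < r, ¬ E (i + j)) : r ≤ failureRun r E n := by
  have h1 : ∀ j ≤ r, j ≤ failureRun r E (i + j) := by
    intro j hj
    induction j with
    | zero => simp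
    | succ j ih =>
      have := ih (by omega)
      rw [← add_assoc]
      rcases le_or_gt r (failureRun r E (i + j)) with hr | hr
      · rw [failureRun_succ_of_le hr]; omega
      · rw [failureRun_succ_of_failure hr (h j (by omega))]; omega
  induction n, hi using Nat.le_induction with
  | base => exact h1 r le_rfl
  | succ n _ ih => rwa [failureRun_succ_of_le ih]

/-! ### Comparison of gaps with runs of empty cells -/

/-- The `i`-th cell of the partition of `[0, ∞)` into intervals of length `δ`. -/
def cell (δ : ℝ) (i : ℕ) : Set ℝ := Set.Ico (i * δ) ((i + 1) * δ)

lemma exists_mem_cell {δ : ℝ} (hδ : 0 < δ) {x : ℝ} (hx : 0 ≤ x) : x ∈ cell δ ⌊x / δ⌋₊ := by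
  constructor
  · exact (le_div_iff₀ hδ).1 (Nat.floor_le (by positivity))
  · exact (div_lt_iff₀ hδ).1 (Nat.lt_floor_add_one _)

lemma disjoint_cell {δ : ℝ} (hδ : 0 < δ) {i j : ℕ} (hij : i ≠ j) :
    Disjoint (cell δ i) (cell δ j) := by
  wlog h : i < j generalizing i j
  · exact (this hij.symm (by omega)).symm
  rw [Set.disjoint_left]
  rintro x ⟨_, hx⟩ ⟨hx', _⟩
  have : ((i : ℝ) + 1) ≤ j := by exact_mod_cast h
  nlinarith

lemma cell_subset {δ : ℝ} (hδ : 0 < δ) {i j r : ℕ} (hj : j < r) :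
    cell δ (i + j) ⊆ Set.Ico (i * δ) ((i + r) * δ) := by
  rintro x ⟨h1, h2⟩
  have : ((j : ℝ) + 1) ≤ r := by exact_mod_cast hj
  push_cast at h1 h2
  constructor <;> nlinarith [(Nat.cast_nonneg j : (0 : ℝ) ≤ j)]

lemma exists_cell_of_mem_Ico {δ : ℝ} (hδ : 0 < δ) {i r : ℕ} {x : ℝ}
    (hx : x ∈ Set.Ico (i * δ) ((i + r) * δ)) : ∃ j < r, x ∈ cell δ (i + j) := by
  have hx0 : 0 ≤ x := le_trans (by positivity) hx.1
  have h1 : i ≤ ⌊x / δ⌋₊ := Nat.le_floor ((le_div_iff₀ hδ).2 hx.1)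
  have h2 : ⌊x / δ⌋₊ < i + r := by
    rw [Nat.floor_lt (by positivity), div_lt_iff₀ hδ]
    exact_mod_cast hx.2
  refine ⟨⌊x / δ⌋₊ - i, by omega, ?_⟩
  rw [Nat.add_sub_cancel' h1]
  exact exists_mem_cell hδ hx0

lemma add_le_nextEpoch_iff {S : Set ℝ} {s ℓ : ℝ} :
    (s : EReal) + (ℓ : EReal) ≤ nextEpoch S s ↔ ∀ x ∈ S, s < x → s + ℓ ≤ x := by
  rw [nextEpoch, le_sInf_iff]
  constructor
  · intro h x hx hsx
    exact_mod_cast h x ⟨x, ⟨hx, hsx⟩, rfl⟩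
  · rintro h _ ⟨x, ⟨hx, hsx⟩, rfl⟩
    exact EReal.coe_le_coe_iff.2 (h x hx hsx)

/-- The last epoch up to the start of `k` empty cells is followed by a gap of at least `k * δ`.
Finiteness guarantees that there is a last one; it is `0` if no point precedes the run. -/
lemma failureRun_lt_of_lt_firstGap {S : Set ℝ} {t δ : ℝ} {k : ℕ} (hδ : 0 < δ)
    (hfin : (S ∩ Set.Iic t).Finite) {n : ℕ} (hn : n * δ ≤ t)
    (h : (t : EReal) < firstGap (k * δ) S) :
    failureRun k (fun i => (S ∩ cell δ i).Nonempty) n < k := by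
  by_contra! hk
  obtain ⟨i, hi, hrun⟩ := exists_failures_of_le_failureRun hk
  have hit : i * δ ≤ t := by
    have : (i : ℝ) ≤ n := by exact_mod_cast (by omega : i ≤ n)
    nlinarith
  have hfin' : (insert 0 (S ∩ Set.Iic (i * δ))).Finite :=
    (hfin.subset (Set.inter_subset_inter_right _ (Set.Iic_subset_Iic.2 hit))).insert 0
  obtain ⟨s, hs, hmax⟩ := Set.exists_max_image _ id hfin' (Set.insert_nonempty _ _)
  have hsi : s ≤ i * δ := by
    rcases hs with rfl | hs
    · positivity
    · exact hs.2
  have hsS : s ∈ insert 0 S := Set.insert_subset_insert Set.inter_subset_left hs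
  have hgap : (s : EReal) + ((k * δ : ℝ) : EReal) ≤ nextEpoch S s := by
    rw [add_le_nextEpoch_iff]
    intro x hx hsx
    have h1 : i * δ < x := by
      by_contra! hxi
      exact absurd (hmax x (Or.inr ⟨hx, hxi⟩)) (not_le.2 hsx)
    by_contra! hlt
    obtain ⟨j, hj, hxj⟩ := exists_cell_of_mem_Ico hδ (i := i) (r := k) (x := x)
      ⟨h1.le, by nlinarith⟩
    exact hrun j hj ⟨x, hx, hxj⟩
  have : firstGap (k * δ) S ≤ (s : EReal) := sInf_le ⟨s, ⟨hsS, hgap⟩, rfl⟩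
  have h2 := lt_of_lt_of_le h this
  rw [EReal.coe_lt_coe_iff] at h2
  linarith

/-- A gap that starts somewhere inside a cell may waste the rest of that cell, so length `(r + 1) *
δ` is needed to cover `r` whole cells. -/
lemma lt_firstGap_of_failureRun_lt {S : Set ℝ} {t δ : ℝ} {r : ℕ} (hδ : 0 < δ)
    (hS : S ⊆ Set.Ioi 0) {n : ℕ} (hn : t + 1 + (r + 1) * δ ≤ n * δ)
    (h : failureRun r (fun i => (S ∩ cell δ i).Nonempty) n < r) :
    (t : EReal) < firstGap ((r + 1) * δ) S := by
  -- Bounding every candidate below by `t + 1` keeps the inequality strict for the infimum.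
  refine lt_of_lt_of_le (b := ((t + 1 : ℝ) : EReal)) (by exact_mod_cast lt_add_one t) ?_
  rw [firstGap, le_sInf_iff]
  rintro _ ⟨s, ⟨hs, hgap⟩, rfl⟩
  rw [add_le_nextEpoch_iff] at hgap
  rw [EReal.coe_le_coe_iff]
  by_contra! hst
  have hs0 : 0 ≤ s := by
    rcases hs with rfl | hs
    · exact le_rfl
    · exact (hS hs).le
  obtain ⟨h1, h2⟩ := exists_mem_cell hδ hs0
  set i := ⌊s / δ⌋₊
  refine absurd h (not_lt.2 (le_failureRun_of_failures (i := i + 1) ?_ ?_))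
  · have : ((i + 1 + r : ℕ) : ℝ) * δ ≤ n * δ := by push_cast; nlinarith
    exact_mod_cast le_of_mul_le_mul_right this hδ
  · rintro j hj ⟨x, hx, hxj⟩
    have hx' := cell_subset hδ hj hxj
    push_cast at hx'
    have := hgap x hx (lt_of_lt_of_le h2 hx'.1)
    have := hx'.2
    nlinarith

/-! ### The killed run-length chain and its survival probability -/

section Chain

variable {Ω : Type*} {mΩ : MeasurableSpace Ω} {P : Measure Ω} {E : ℕ → Set Ω}

/-- The state at time `n` depends only on the events before `n`; this makes it independent of `E n`.
-/
lemma measurable_failureRun (E : ℕ → Set Ω) (r n : ℕ) :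
    Measurable[⨆ i ∈ Set.Iio n, MeasurableSpace.generateFrom {E i}]
      fun ω => failureRun r (fun i => ω ∈ E i) n := by
  induction n with
  | zero => exact measurable_const
  | succ n ih =>
    have hle : (⨆ i ∈ Set.Iio n, MeasurableSpace.generateFrom {E i}) ≤
        ⨆ i ∈ Set.Iio (n + 1), MeasurableSpace.generateFrom {E i} :=
      biSup_mono fun i hi => lt_trans hi (Nat.lt_succ_self n)
    have ih' := ih.mono hle le_rfl
    have hEn : MeasurableSet[⨆ i ∈ Set.Iio (n + 1), MeasurableSpace.generateFrom {E i}]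
        {ω | ω ∈ E n} :=
      le_iSup₂_of_le (f := fun i (_ : i ∈ Set.Iio (n + 1)) =>
        MeasurableSpace.generateFrom {E i}) n (Nat.lt_succ_self n) le_rfl _
        (MeasurableSpace.measurableSet_generateFrom (Set.mem_singleton _))
    simp only [failureRun]
    refine Measurable.ite (ih' (measurableSet_Ici (a := r))) ih' ?_
    exact Measurable.ite hEn measurable_const (ih'.add_const 1)

lemma measureReal_failureRun_inter (hE : ∀ i, MeasurableSet (E i)) (hind : iIndepSet E P)
    (r n : ℕ) (J : Set ℕ) {F : Set Ω}
    (hF : MeasurableSet[MeasurableSpace.generateFrom {E n}] F) :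
    P.real ({ω | failureRun r (fun i => ω ∈ E i) n ∈ J} ∩ F) =
      P.real {ω | failureRun r (fun i => ω ∈ E i) n ∈ J} * P.real F := by
  have hle : ∀ i, MeasurableSpace.generateFrom {E i} ≤ mΩ := fun i =>
    MeasurableSpace.generateFrom_le (by rintro _ rfl; exact hE i)
  have h := indep_iSup_of_disjoint hle ((iIndepSet_iff_iIndep _ _).1 hind)
    (S := Set.Iio n) (T := {n}) (by simp)
  simp only [Set.mem_singleton_iff, iSup_iSup_eq_left] at h
  simp only [measureReal_def, ← ENNReal.toReal_mul]
  congr 1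
  exact (Indep_iff _ _ _).1 h _ _ (measurable_failureRun E r n (MeasurableSet.of_discrete (s := J))) hF

lemma measurableSet_failureRun (hE : ∀ i, MeasurableSet (E i)) (r n : ℕ) (J : Set ℕ) :
    MeasurableSet {ω | failureRun r (fun i => ω ∈ E i) n ∈ J} := by
  have hle : (⨆ i ∈ Set.Iio n, MeasurableSpace.generateFrom {E i}) ≤ mΩ :=
    iSup₂_le fun i _ => MeasurableSpace.generateFrom_le (by rintro _ rfl; exact hE i)
  exact hle _ (measurable_failureRun E r n (MeasurableSet.of_discrete (s := J)))

/-- The law of the length of the current run of failures at time `n`. -/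
noncomputable def runLaw (P : Measure Ω) (E : ℕ → Set Ω) (r n j : ℕ) : ℝ :=
  P.real {ω | failureRun r (fun i => ω ∈ E i) n ∈ ({j} : Set ℕ)}

lemma runLaw_nonneg (r n j : ℕ) : 0 ≤ runLaw P E r n j := measureReal_nonneg

variable [IsProbabilityMeasure P]

lemma measureReal_failureRun_lt (hE : ∀ i, MeasurableSet (E i)) (r n : ℕ) :
    P.real {ω | failureRun r (fun i => ω ∈ E i) n < r} =
      ∑ j ∈ Finset.range r, runLaw P E r n j := by
  unfold runLaw
  rw [← measureReal_biUnion_finset]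
  · congr 1
    ext ω
    simp
  · intro i _ j _ hij
    refine Set.disjoint_left.2 fun ω h1 h2 => hij ?_
    simp only [Set.mem_singleton_iff, Set.mem_ofPred_eq] at h1 h2
    omega
  · exact fun j _ => measurableSet_failureRun hE r n _

lemma runLaw_succ_zero (hE : ∀ i, MeasurableSet (E i)) (hind : iIndepSet E P) {r : ℕ}
    (hr : 0 < r) (n : ℕ) :
    runLaw P E r (n + 1) 0 = P.real (E n) * ∑ j ∈ Finset.range r, runLaw P E r n j := by
  rw [← measureReal_failureRun_lt hE, mul_comm]
  have := measureReal_failureRun_inter hE hind r n (Set.Iio r)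
    (MeasurableSpace.measurableSet_generateFrom (Set.mem_singleton (E n)))
  simp only [Set.mem_Iio] at this
  rw [← this, runLaw]
  congr 1
  ext ω
  simp only [failureRun, Set.mem_singleton_iff, Set.mem_ofPred_eq, Set.mem_inter_iff]
  split_ifs with h1 h2 <;> grind

lemma runLaw_succ_succ (hE : ∀ i, MeasurableSet (E i)) (hind : iIndepSet E P) {r j : ℕ}
    (hj : j + 1 < r) (n : ℕ) :
    runLaw P E r (n + 1) (j + 1) = (1 - P.real (E n)) * runLaw P E r n j := by
  rw [← probReal_compl_eq_one_sub (hE n), mul_comm]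
  have := measureReal_failureRun_inter hE hind r n {j}
    (MeasurableSpace.measurableSet_generateFrom (Set.mem_singleton (E n))).compl
  rw [runLaw, runLaw, ← this]
  congr 1
  ext ω
  simp only [failureRun, Set.mem_singleton_iff, Set.mem_ofPred_eq, Set.mem_inter_iff,
    Set.mem_compl_iff]
  split_ifs with h1 h2 <;> grind

lemma runLaw_zero_pos (hE : ∀ i, MeasurableSet (E i)) (hind : iIndepSet E P)
    (hpos : ∀ i, 0 < P.real (E i)) {r : ℕ} (hr : 0 < r) (n : ℕ) : 0 < runLaw P E r n 0 := by
  induction n with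
  | zero => simp [runLaw, failureRun]
  | succ n ih =>
    rw [runLaw_succ_zero hE hind hr]
    exact mul_pos (hpos n) (Finset.sum_pos' (fun j _ => runLaw_nonneg r n j)
      ⟨0, Finset.mem_range.2 hr, ih⟩)

lemma measureReal_failureRun_lt_pos (hE : ∀ i, MeasurableSet (E i)) (hind : iIndepSet E P)
    (hpos : ∀ i, 0 < P.real (E i)) {r : ℕ} (hr : 0 < r) (n : ℕ) :
    0 < P.real {ω | failureRun r (fun i => ω ∈ E i) n < r} := by
  rw [measureReal_failureRun_lt hE]
  exact Finset.sum_pos' (fun j _ => runLaw_nonneg r n j)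
      ⟨0, Finset.mem_range.2 hr, runLaw_zero_pos hE hind hpos hr n⟩

lemma exists_le_mul_pow {x : ℕ → ℝ} {ρ : ℝ} (hx : ∀ n, 0 ≤ x n) (hρ : 0 < ρ)
    (h : ∀ᶠ n in atTop, x (n + 1) ≤ ρ * x n) : ∃ C > 0, ∀ n, x n ≤ C * ρ ^ n := by
  obtain ⟨N, hN⟩ := eventually_atTop.1 h
  -- The constant absorbs the finitely many times before the recursion holds; the `1` makes it
  -- positive.
  set C := 1 + ∑ i ∈ Finset.range (N + 1), x i / ρ ^ i
  have hnn : ∀ i, 0 ≤ x i / ρ ^ i := fun i => div_nonneg (hx i) (by positivity)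
  have h1 : ∀ n ≤ N, x n ≤ C * ρ ^ n := by
    intro n hn
    rw [← div_le_iff₀ (by positivity)]
    have := Finset.single_le_sum (fun i _ => hnn i) (Finset.mem_range.2 (by omega : n < N + 1))
    linarith
  refine ⟨C, by linarith [Finset.sum_nonneg fun i (_ : i ∈ Finset.range (N + 1)) => hnn i],
    fun n => ?_⟩
  rcases le_total n N with hn | hn
  · exact h1 n hn
  · induction n, hn using Nat.le_induction with
    | base => exact h1 N le_rfl
    | succ n hn ih =>
      calc x (n + 1) ≤ ρ * x n := hN n hn
        _ ≤ ρ * (C * ρ ^ n) := by gcongr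
        _ = C * ρ ^ (n + 1) := by ring

lemma exists_mul_pow_le {x : ℕ → ℝ} {ρ : ℝ} (hx : ∀ n, 0 < x n) (hρ : 0 < ρ)
    (h : ∀ᶠ n in atTop, ρ * x n ≤ x (n + 1)) : ∃ c > 0, ∀ n, c * ρ ^ n ≤ x n := by
  obtain ⟨C, hC, hb⟩ := exists_le_mul_pow (x := fun n => (x n)⁻¹) (ρ := ρ⁻¹)
    (fun n => (inv_pos.2 (hx n)).le) (inv_pos.2 hρ) (by
      filter_upwards [h] with n hn
      rw [← mul_inv]
      exact inv_anti₀ (mul_pos hρ (hx n)) hn)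
  refine ⟨C⁻¹, inv_pos.2 hC, fun n => ?_⟩
  have := inv_anti₀ (inv_pos.2 (hx n)) (hb n)
  rwa [inv_inv, mul_inv, ← inv_pow, inv_inv] at this

/-- The generator of the chain moves from its law to the weight. Mass that reaches level `r` is
lost, which `h r = 0` accounts for. -/
lemma sum_runLaw_succ_mul (hE : ∀ i, MeasurableSet (E i)) (hind : iIndepSet E P) {r : ℕ}
    (hr : 0 < r) {h : ℕ → ℝ} (hh : h r = 0) (n : ℕ) :
    ∑ j ∈ Finset.range r, runLaw P E r (n + 1) j * h j =
      ∑ j ∈ Finset.range r, runLaw P E r n j *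
        (P.real (E n) * h 0 + (1 - P.real (E n)) * h (j + 1)) := by
  obtain ⟨r, rfl⟩ := Nat.exists_eq_add_one.2 hr
  rw [Finset.sum_range_succ', runLaw_succ_zero hE hind hr]
  have h1 : ∑ k ∈ Finset.range r, runLaw P E (r + 1) (n + 1) (k + 1) * h (k + 1) =
      ∑ k ∈ Finset.range (r + 1),
        (1 - P.real (E n)) * runLaw P E (r + 1) n k * h (k + 1) := by
    rw [Finset.sum_range_succ, hh, mul_zero, add_zero]
    refine Finset.sum_congr rfl fun k hk => ?_
    rw [runLaw_succ_succ hE hind (by simpa using hk)]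
  rw [h1, Finset.mul_sum, Finset.sum_mul, ← Finset.sum_add_distrib]
  exact Finset.sum_congr rfl fun k _ => by ring

/-- The `h`-weighted mass eventually contracts by `ρ`, and it controls the unweighted mass because
`h` is bounded below on the finitely many live states. -/
theorem exists_failureRun_le_mul_pow (hE : ∀ i, MeasurableSet (E i)) (hind : iIndepSet E P)
    {r : ℕ} (hr : 0 < r) {h : ℕ → ℝ} (hh : h r = 0) (hpos : ∀ j < r, 0 < h j)
    {ρ : ℝ} (hρ : 0 < ρ)
    (hsup : ∀ᶠ n in atTop, ∀ j < r,
      P.real (E n) * h 0 + (1 - P.real (E n)) * h (j + 1) ≤ ρ * h j) :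
    ∃ C > 0, ∀ n, P.real {ω | failureRun r (fun i => ω ∈ E i) n < r} ≤ C * ρ ^ n := by
  obtain ⟨C, hC, hb⟩ := exists_le_mul_pow
    (x := fun n => ∑ j ∈ Finset.range r, runLaw P E r n j * h j)
    (fun n => Finset.sum_nonneg fun j hj =>
      mul_nonneg (runLaw_nonneg r n j) (hpos j (Finset.mem_range.1 hj)).le) hρ (by
      filter_upwards [hsup] with n hn
      rw [sum_runLaw_succ_mul hE hind hr hh, Finset.mul_sum]
      refine Finset.sum_le_sum fun j hj => ?_
      have := mul_le_mul_of_nonneg_left (hn j (Finset.mem_range.1 hj))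
        (runLaw_nonneg (P := P) (E := E) r n j)
      linarith)
  obtain ⟨i, hi, hmin⟩ := Finset.exists_min_image (Finset.range r) h ⟨0, Finset.mem_range.2 hr⟩
  have hi0 := hpos i (Finset.mem_range.1 hi)
  refine ⟨C / h i, by positivity, fun n => ?_⟩
  rw [measureReal_failureRun_lt hE, div_mul_eq_mul_div, le_div_iff₀ hi0, Finset.sum_mul]
  refine le_trans (Finset.sum_le_sum fun j hj => ?_) (hb n)
  exact mul_le_mul_of_nonneg_left (hmin j hj) (runLaw_nonneg r n j)

theorem exists_mul_pow_le_failureRun (hE : ∀ i, MeasurableSet (E i)) (hind : iIndepSet E P)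
    (hEpos : ∀ i, 0 < P.real (E i))
    {r : ℕ} (hr : 0 < r) {h : ℕ → ℝ} (hh : h r = 0) (hpos : ∀ j < r, 0 < h j)
    {ρ : ℝ} (hρ : 0 < ρ)
    (hsub : ∀ᶠ n in atTop, ∀ j < r,
      ρ * h j ≤ P.real (E n) * h 0 + (1 - P.real (E n)) * h (j + 1)) :
    ∃ c > 0, ∀ n, c * ρ ^ n ≤ P.real {ω | failureRun r (fun i => ω ∈ E i) n < r} := by
  obtain ⟨C, hC, hb⟩ := exists_mul_pow_le
    (x := fun n => ∑ j ∈ Finset.range r, runLaw P E r n j * h j)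
    (fun n => Finset.sum_pos' (fun j hj =>
      mul_nonneg (runLaw_nonneg r n j) (hpos j (Finset.mem_range.1 hj)).le)
      ⟨0, Finset.mem_range.2 hr, mul_pos (runLaw_zero_pos hE hind hEpos hr n) (hpos 0 hr)⟩) hρ (by
      filter_upwards [hsub] with n hn
      rw [sum_runLaw_succ_mul hE hind hr hh, Finset.mul_sum]
      refine Finset.sum_le_sum fun j hj => ?_
      have := mul_le_mul_of_nonneg_left (hn j (Finset.mem_range.1 hj))
        (runLaw_nonneg (P := P) (E := E) r n j)
      linarith)
  obtain ⟨i, hi, hmax⟩ := Finset.exists_max_image (Finset.range r) h ⟨0, Finset.mem_range.2 hr⟩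
  have hi0 := hpos i (Finset.mem_range.1 hi)
  refine ⟨C / h i, by positivity, fun n => ?_⟩
  rw [measureReal_failureRun_lt hE, div_mul_eq_mul_div, div_le_iff₀ hi0, Finset.sum_mul]
  refine le_trans (hb n) (Finset.sum_le_sum fun j hj => ?_)
  exact mul_le_mul_of_nonneg_left (hmax j hj) (runLaw_nonneg r n j)

end Chain

/-! ### Intensity of a cell -/

section Intensity

variable {μ : ℝ → ℝ}

lemma intensity_apply {B : Set ℝ} (hB : MeasurableSet B) :
    intensity μ B = ∫⁻ t in B ∩ Set.Ioi 0, ENNReal.ofReal (μ t) := by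
  rw [intensity, withDensity_apply _ hB, Measure.restrict_restrict hB]

lemma intensity_ne_top_of_subset_Iio (hμ : ∀ t : ℝ, IntegrableOn μ (Set.Ioo 0 t)) {B : Set ℝ}
    (hB : MeasurableSet B) {t : ℝ} (h : B ⊆ Set.Iio t) : intensity μ B ≠ ⊤ := by
  rw [intensity_apply hB]
  exact (Integrable.lintegral_lt_top
    ((hμ t).mono_set (fun x hx => ⟨hx.2, h hx.1⟩))).ne

lemma measurableSet_cell (δ : ℝ) (i : ℕ) : MeasurableSet (cell δ i) := measurableSet_Ico

lemma intensity_cell_ne_top (hμ : ∀ t : ℝ, IntegrableOn μ (Set.Ioo 0 t)) (δ : ℝ) (i : ℕ) :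
    intensity μ (cell δ i) ≠ ⊤ :=
  intensity_ne_top_of_subset_Iio hμ (measurableSet_cell δ i) Set.Ico_subset_Iio_self

lemma volume_cell_inter {δ : ℝ} (hδ : 0 < δ) (i : ℕ) :
    volume (cell δ i ∩ Set.Ioi 0) = ENNReal.ofReal δ := by
  have h : volume (cell δ i) = ENNReal.ofReal δ := by
    rw [cell, Real.volume_Ico]; congr 1; ring
  refine le_antisymm (h ▸ measure_mono Set.inter_subset_left) ?_
  have h2 : volume (Set.Ioo ((i : ℝ) * δ) ((i + 1) * δ)) = ENNReal.ofReal δ := by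
    rw [Real.volume_Ioo]; congr 1; ring
  rw [← h2]
  refine measure_mono fun x hx => ⟨⟨hx.1.le, hx.2⟩, ?_⟩
  have : 0 ≤ (i : ℝ) * δ := by positivity
  exact lt_of_le_of_lt this hx.1

lemma intensity_cell_pos (hμ : ∀ t : ℝ, IntegrableOn μ (Set.Ioo 0 t))
    (hpos : ∀ᵐ t ∂(volume.restrict (Set.Ioi (0 : ℝ))), 0 < μ t) {δ : ℝ} (hδ : 0 < δ) (i : ℕ) :
    0 < (intensity μ (cell δ i)).toReal := by
  refine ENNReal.toReal_pos (fun h0 => ?_) (intensity_cell_ne_top hμ δ i)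
  rw [intensity_apply (measurableSet_cell δ i), lintegral_eq_zero_iff'] at h0
  · have h1 := ae_restrict_of_ae_restrict_of_subset
      (Set.inter_subset_right (s := cell δ i)) hpos
    have h2 : ∀ᵐ t ∂(volume.restrict (cell δ i ∩ Set.Ioi 0)), False := by
      filter_upwards [h0, h1] with t ht0 ht1
      simp only [Pi.zero_apply, ENNReal.ofReal_eq_zero] at ht0
      linarith
    rw [eventually_false_iff_eq_bot, ae_eq_bot, Measure.restrict_eq_zero,
      volume_cell_inter hδ] at h2
    simp only [ENNReal.ofReal_eq_zero] at h2
    linarith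
  · exact ((hμ ((i + 1) * δ)).mono_set
      (fun x hx => ⟨hx.2, hx.1.2⟩)).aemeasurable.ennreal_ofReal

lemma eventually_forall_mem_cell {δ : ℝ} (hδ : 0 < δ) {p : ℝ → Prop}
    (h : ∀ᶠ t in atTop, p t) : ∀ᶠ i : ℕ in atTop, ∀ t ∈ cell δ i, p t := by
  obtain ⟨T, hT⟩ := eventually_atTop.1 h
  have : Tendsto (fun i : ℕ => (i : ℝ) * δ) atTop atTop :=
    tendsto_natCast_atTop_atTop.atTop_mul_const hδ
  filter_upwards [this.eventually_ge_atTop T] with i hi t ht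
  exact hT t (hi.trans ht.1)

lemma eventually_intensity_cell_le {δ c : ℝ} (hδ : 0 < δ) (hc : 0 ≤ c)
    (h : ∀ᶠ t in atTop, μ t ≤ c) :
    ∀ᶠ i : ℕ in atTop, (intensity μ (cell δ i)).toReal ≤ c * δ := by
  filter_upwards [eventually_forall_mem_cell hδ h] with i hi
  refine ENNReal.toReal_le_of_le_ofReal (by positivity) ?_
  rw [intensity_apply (measurableSet_cell δ i), ENNReal.ofReal_mul hc, ← volume_cell_inter hδ i,
    ← setLIntegral_const]
  exact setLIntegral_mono' ((measurableSet_cell δ i).inter measurableSet_Ioi)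
    fun x hx => ENNReal.ofReal_le_ofReal (hi x hx.1)

lemma eventually_le_intensity_cell (hμ : ∀ t : ℝ, IntegrableOn μ (Set.Ioo 0 t)) {δ c : ℝ}
    (hδ : 0 < δ) (h : ∀ᶠ t in atTop, c ≤ μ t) :
    ∀ᶠ i : ℕ in atTop, c * δ ≤ (intensity μ (cell δ i)).toReal := by
  rcases lt_or_ge c 0 with hc | hc
  · refine Eventually.of_forall fun i => le_trans ?_ ENNReal.toReal_nonneg
    nlinarith
  filter_upwards [eventually_forall_mem_cell hδ h] with i hi
  rw [← ENNReal.ofReal_le_iff_le_toReal (intensity_cell_ne_top hμ δ i),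
    intensity_apply (measurableSet_cell δ i), ENNReal.ofReal_mul hc, ← volume_cell_inter hδ i,
    ← setLIntegral_const]
  exact setLIntegral_mono' ((measurableSet_cell δ i).inter measurableSet_Ioi)
    fun x hx => ENNReal.ofReal_le_ofReal (hi x hx.1)

lemma tendsto_intensity_cell (hμ : ∀ t : ℝ, IntegrableOn μ (Set.Ioo 0 t)) {δ m : ℝ}
    (hδ : 0 < δ) (hm : 0 ≤ m) (h : Tendsto μ atTop (𝓝 m)) :
    Tendsto (fun i : ℕ => (intensity μ (cell δ i)).toReal) atTop (𝓝 (m * δ)) := by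
  rw [tendsto_order]
  constructor
  · intro a ha
    obtain ⟨c, hc1, hc2⟩ := exists_between ((div_lt_iff₀ hδ).2 ha)
    filter_upwards [eventually_le_intensity_cell hμ hδ (h.eventually_const_le hc2)] with i hi
    exact lt_of_lt_of_le ((div_lt_iff₀ hδ).1 hc1) hi
  · intro a ha
    obtain ⟨c, hc1, hc2⟩ := exists_between ((lt_div_iff₀ hδ).2 ha)
    filter_upwards [eventually_intensity_cell_le hδ (hm.trans hc1.le)
      (h.eventually_le_const hc1)] with i hi
    exact lt_of_le_of_lt hi ((lt_div_iff₀ hδ).1 hc2)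

lemma tendsto_intensity_cell_atTop (hμ : ∀ t : ℝ, IntegrableOn μ (Set.Ioo 0 t)) {δ : ℝ}
    (hδ : 0 < δ) (h : Tendsto μ atTop atTop) :
    Tendsto (fun i : ℕ => (intensity μ (cell δ i)).toReal) atTop atTop := by
  rw [tendsto_atTop]
  intro b
  filter_upwards [eventually_le_intensity_cell hμ hδ (h.eventually_ge_atTop (b / δ))] with i hi
  rwa [div_mul_cancel₀ _ hδ.ne'] at hi

end Intensity

/-! ### Occupied cells of the Poisson process and exponential bounds on the tail -/

section Poisson

variable {Ω : Type*} [MeasurableSpace Ω] {P : Measure Ω} {N : Ω → Set ℝ} {μ : ℝ → ℝ}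

/-- The event that the `i`-th cell contains a point. -/
def occupied (N : Ω → Set ℝ) (δ : ℝ) (i : ℕ) : Set Ω := {ω | (N ω ∩ cell δ i).Nonempty}

omit [MeasurableSpace Ω] in
lemma occupied_eq_preimage (N : Ω → Set ℝ) (δ : ℝ) (i : ℕ) :
    occupied N δ i = (fun ω => (N ω ∩ cell δ i).encard) ⁻¹' {0}ᶜ := by
  ext ω
  simp [occupied, Set.nonempty_iff_ne_empty]

lemma measurableSet_occupied {M : Measure ℝ} (hN : IsPoissonProcess P N M) (δ : ℝ) (i : ℕ) :
    MeasurableSet (occupied N δ i) := by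
  rw [occupied_eq_preimage]
  exact hN.measurable_count _ (measurableSet_cell δ i) (MeasurableSet.of_discrete)

lemma iIndepSet_occupied {M : Measure ℝ} (hN : IsPoissonProcess P N M) {δ : ℝ} (hδ : 0 < δ) :
    iIndepSet (occupied N δ) P := by
  rw [iIndepSet_iff_meas_biInter (measurableSet_occupied hN δ)]
  intro s
  -- Independence is given for families indexed by `Fin n`, so the finite index set is enumerated.
  have h := hN.indep_count s.card (fun j => cell δ (s.equivFin.symm j))
    (fun _ => measurableSet_cell _ _) fun i j hij => disjoint_cell hδ
      (fun h => hij (s.equivFin.symm.injective (Subtype.ext h)))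
  have h2 := h.measure_inter_preimage_eq_mul (S := Finset.univ) (sets := fun _ => {0}ᶜ)
    (fun _ _ => MeasurableSet.of_discrete)
  simp only [← occupied_eq_preimage] at h2
  rw [← Finset.prod_coe_sort, ← s.equivFin.symm.prod_comp, ← h2]
  congr 1
  ext ω
  simp only [Set.mem_iInter, Finset.mem_univ, true_imp_iff]
  constructor
  · intro hω j
    exact hω _ (s.equivFin.symm j).2
  · intro hω i hi
    simpa using hω (s.equivFin ⟨i, hi⟩)

lemma measureReal_occupied [IsProbabilityMeasure P] {M : Measure ℝ}
    (hN : IsPoissonProcess P N M) {δ : ℝ} {i : ℕ} (hM : M (cell δ i) ≠ ⊤) :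
    P.real (occupied N δ i) = 1 - Real.exp (-(M (cell δ i)).toReal) := by
  have h := (hN.law_count _ (measurableSet_cell δ i) hM).measureReal_eq
    (p := fun x => x = 0) (MeasurableSet.of_discrete)
  have h2 : occupied N δ i = {ω | (N ω ∩ cell δ i).encard = 0}ᶜ := by
    ext ω
    simp [occupied, Set.nonempty_iff_ne_empty]
  have hm : MeasurableSet {ω | (N ω ∩ cell δ i).encard = 0} :=
    hN.measurable_count _ (measurableSet_cell δ i) (MeasurableSet.of_discrete (s := {0}))
  rw [h2, probReal_compl_eq_one_sub hm, h, map_measureReal_apply .of_discrete .of_discrete]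
  have : (Nat.cast : ℕ → ℕ∞) ⁻¹' {x | x = 0} = {0} := by ext; simp
  rw [this, poissonMeasure_real_singleton]
  simp [ENNReal.coe_toNNReal_eq_toReal]

lemma ae_finite_inter {M : Measure ℝ} (hN : IsPoissonProcess P N M) {B : Set ℝ}
    (hB : MeasurableSet B) (hM : M B ≠ ⊤) : ∀ᵐ ω ∂P, (N ω ∩ B).Finite := by
  have h := (hN.law_count B hB hM).ae_iff (p := fun x => x ≠ ⊤)
    (measurable_of_countable _)
  simp only [Set.encard_ne_top_iff] at h
  rw [h, ae_map_iff (Measurable.of_discrete).aemeasurable .of_discrete]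
  exact Eventually.of_forall fun n => ENat.natCast_ne_top n

variable [IsProbabilityMeasure P]

/-- The inclusion of events holds only almost surely, where there are finitely many points up to
`t`. Monotonicity of `P` needs no measurability of the event `D > t`. -/
lemma gapTail_le_measureReal (hμ : ∀ t : ℝ, IntegrableOn μ (Set.Ioo 0 t))
    (hN : IsPoissonProcess P N (intensity μ)) {δ t : ℝ} (hδ : 0 < δ) (k : ℕ) {n : ℕ}
    (hn : n * δ ≤ t) :
    gapTail P N (k * δ) t ≤ P.real {ω | failureRun k (fun i => ω ∈ occupied N δ i) n < k} := by
  refine ENNReal.toReal_mono (measure_ne_top _ _) (measure_mono_ae ?_)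
  filter_upwards [ae_finite_inter hN (measurableSet_Iic (a := t))
    (intensity_ne_top_of_subset_Iio hμ measurableSet_Iic
      (Set.Iic_subset_Iio.2 (lt_add_one t)))] with ω hω h
  exact failureRun_lt_of_lt_firstGap hδ hω hn h

lemma measureReal_le_gapTail {M : Measure ℝ} (hN : IsPoissonProcess P N M) {δ t : ℝ}
    (hδ : 0 < δ) (r : ℕ) {n : ℕ} (hn : t + 1 + (r + 1) * δ ≤ n * δ) :
    P.real {ω | failureRun r (fun i => ω ∈ occupied N δ i) n < r} ≤
      gapTail P N ((r + 1) * δ) t :=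
  measureReal_mono fun ω h => lt_firstGap_of_failureRun_lt hδ (hN.subset ω) hn h

lemma measureReal_occupied_pos (hμ : ∀ t : ℝ, IntegrableOn μ (Set.Ioo 0 t))
    (hpos : ∀ᵐ t ∂(volume.restrict (Set.Ioi (0 : ℝ))), 0 < μ t)
    (hN : IsPoissonProcess P N (intensity μ)) {δ : ℝ} (hδ : 0 < δ) (i : ℕ) :
    0 < P.real (occupied N δ i) := by
  rw [measureReal_occupied hN (intensity_cell_ne_top hμ δ i), sub_pos, Real.exp_lt_one_iff]
  linarith [intensity_cell_pos hμ hpos hδ i]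

theorem gapTail_pos (hμ : ∀ t : ℝ, IntegrableOn μ (Set.Ioo 0 t))
    (hpos : ∀ᵐ t ∂(volume.restrict (Set.Ioi (0 : ℝ))), 0 < μ t)
    (hN : IsPoissonProcess P N (intensity μ)) {ℓ : ℝ} (hℓ : 0 < ℓ) (t : ℝ) :
    0 < gapTail P N ℓ t := by
  have hδ : 0 < ℓ / 2 := by positivity
  obtain ⟨n, hn⟩ := exists_nat_ge ((t + 1 + ((1 : ℕ) + 1) * (ℓ / 2)) / (ℓ / 2))
  have h := measureReal_le_gapTail hN hδ 1 ((div_le_iff₀ hδ).1 hn)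
  rw [show ((1 : ℕ) + 1 : ℝ) * (ℓ / 2) = ℓ by push_cast; ring] at h
  exact lt_of_lt_of_le (measureReal_failureRun_lt_pos (measurableSet_occupied hN _)
    (iIndepSet_occupied hN hδ) (measureReal_occupied_pos hμ hpos hN hδ) one_pos n) h

theorem exists_gapTail_le_exp (hμ : ∀ t : ℝ, IntegrableOn μ (Set.Ioo 0 t))
    (hN : IsPoissonProcess P N (intensity μ)) {δ : ℝ} (hδ : 0 < δ) {k : ℕ} (hk : 0 < k)
    {h : ℕ → ℝ} (hh : h k = 0) (hpos : ∀ j < k, 0 < h j) {a : ℝ} (ha : 0 ≤ a)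
    (hsup : ∀ᶠ n in atTop, ∀ j < k, P.real (occupied N δ n) * h 0 +
      (1 - P.real (occupied N δ n)) * h (j + 1) ≤ Real.exp (-(a * δ)) * h j) :
    ∃ C > 0, ∀ t ≥ 0, gapTail P N (k * δ) t ≤ C * Real.exp (-(a * t)) := by
  obtain ⟨C, hC, hb⟩ := exists_failureRun_le_mul_pow (measurableSet_occupied hN δ)
    (iIndepSet_occupied hN hδ) hk hh hpos (Real.exp_pos _) hsup
  -- Rounding `t / δ` down loses at most one cell, hence the factor `exp (a δ)`.
  refine ⟨C * Real.exp (a * δ), by positivity, fun t ht => ?_⟩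
  refine (gapTail_le_measureReal hμ hN hδ k (n := ⌊t / δ⌋₊)
    ((le_div_iff₀ hδ).1 (Nat.floor_le (by positivity)))).trans ((hb _).trans ?_)
  rw [mul_assoc, ← Real.exp_add, ← Real.exp_nat_mul]
  have h1 := ((div_lt_iff₀ hδ).1 (Nat.lt_floor_add_one (t / δ))).le
  gcongr
  nlinarith

theorem exists_exp_le_gapTail (hμ : ∀ t : ℝ, IntegrableOn μ (Set.Ioo 0 t))
    (hμpos : ∀ᵐ t ∂(volume.restrict (Set.Ioi (0 : ℝ))), 0 < μ t)
    (hN : IsPoissonProcess P N (intensity μ)) {δ : ℝ} (hδ : 0 < δ) {r : ℕ} (hr : 0 < r)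
    {h : ℕ → ℝ} (hh : h r = 0) (hpos : ∀ j < r, 0 < h j) {a : ℝ} (ha : 0 ≤ a)
    (hsub : ∀ᶠ n in atTop, ∀ j < r, Real.exp (-(a * δ)) * h j ≤ P.real (occupied N δ n) * h 0 +
      (1 - P.real (occupied N δ n)) * h (j + 1)) :
    ∃ c > 0, ∀ t ≥ 0, c * Real.exp (-(a * t)) ≤ gapTail P N ((r + 1) * δ) t := by
  obtain ⟨c, hc, hb⟩ := exists_mul_pow_le_failureRun (measurableSet_occupied hN δ)
    (iIndepSet_occupied hN hδ) (measureReal_occupied_pos hμ hμpos hN hδ) hr hh hpos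
    (Real.exp_pos _) hsub
  -- The chain must run up to `t + 1 + (r + 1) * δ`, and rounding up adds at most one more `δ`.
  refine ⟨c * Real.exp (-(a * (1 + (r + 2) * δ))), by positivity, fun t ht => ?_⟩
  have h0 : 0 ≤ (t + 1 + (r + 1) * δ) / δ := by positivity
  refine le_trans ?_ ((hb ⌈(t + 1 + (r + 1) * δ) / δ⌉₊).trans
    (measureReal_le_gapTail hN hδ r ((div_le_iff₀ hδ).1 (Nat.le_ceil _))))
  rw [mul_assoc, ← Real.exp_add, ← Real.exp_nat_mul]
  have h1 : (⌈(t + 1 + (r + 1) * δ) / δ⌉₊ : ℝ) * δ ≤ t + 1 + (r + 1) * δ + δ := by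
    have := mul_le_mul_of_nonneg_right (Nat.ceil_lt_add_one h0).le hδ.le
    rwa [add_mul (_ / _), div_mul_cancel₀ _ hδ.ne', one_mul] at this
  gcongr
  nlinarith

end Poisson

/-! ### From exponential bounds to the logarithmic rate -/

section Rate

lemma eventually_le_neg_log_div {f : ℝ → ℝ} (hf : ∀ t, 0 < f t) {a b : ℝ} (hb : b < a)
    (h : ∃ C > 0, ∀ t ≥ 0, f t ≤ C * Real.exp (-(a * t))) :
    ∀ᶠ t in atTop, b ≤ -Real.log (f t) / t := by
  obtain ⟨C, hC, h⟩ := h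
  filter_upwards [eventually_gt_atTop 0, eventually_ge_atTop (Real.log C / (a - b))] with t ht htC
  have h1 := Real.log_le_log (hf t) (h t ht.le)
  rw [Real.log_mul hC.ne' (Real.exp_ne_zero _), Real.log_exp] at h1
  rw [div_le_iff₀ (sub_pos.2 hb)] at htC
  rw [le_div_iff₀ ht]
  linarith

lemma eventually_neg_log_div_le {f : ℝ → ℝ} {a b : ℝ} (hb : a < b)
    (h : ∃ c > 0, ∀ t ≥ 0, c * Real.exp (-(a * t)) ≤ f t) :
    ∀ᶠ t in atTop, -Real.log (f t) / t ≤ b := by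
  obtain ⟨c, hc, h⟩ := h
  filter_upwards [eventually_gt_atTop 0, eventually_ge_atTop (-Real.log c / (b - a))] with t ht htC
  have h1 := Real.log_le_log (by positivity) (h t ht.le)
  rw [Real.log_mul hc.ne' (Real.exp_ne_zero _), Real.log_exp] at h1
  rw [div_le_iff₀ (sub_pos.2 hb)] at htC
  rw [div_le_iff₀ ht]
  linarith

end Rate

/-! ### The equation for the decay rate and its discretization -/

section Renewal

/-- The equation for the decay rate is `renewalIntegral ℓ m γ = 1`. -/
noncomputable def renewalIntegral (x m γ : ℝ) : ℝ :=
  ∫ s in (0 : ℝ)..x, m * Real.exp ((γ - m) * s)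

lemma continuous_renewalIntegral_right (x m : ℝ) : Continuous (renewalIntegral x m) :=
  intervalIntegral.continuous_parametric_intervalIntegral_of_continuous' (by fun_prop) _ _

lemma continuous_renewalIntegral_left (m γ : ℝ) :
    Continuous fun x => renewalIntegral x m γ :=
  intervalIntegral.continuous_primitive (fun _ _ => Continuous.intervalIntegrable (by fun_prop) _ _)
    0

lemma strictMono_renewalIntegral {ℓ m : ℝ} (hℓ : 0 < ℓ) (hm : 0 < m) :
    StrictMono (renewalIntegral ℓ m) := by
  intro a b hab
  refine intervalIntegral.integral_lt_integral_of_continuousOn_of_le_of_exists_lt hℓ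
    (by fun_prop) (by fun_prop) (fun x hx => ?_) ⟨ℓ, ⟨hℓ.le, le_rfl⟩, ?_⟩
  · have := hx.1
    gcongr
  · gcongr

lemma integral_mul_exp_neg (m a b : ℝ) :
    ∫ s in a..b, m * Real.exp (-(m * s)) = Real.exp (-(m * a)) - Real.exp (-(m * b)) := by
  rw [intervalIntegral.integral_eq_sub_of_hasDerivAt (f := fun s => -Real.exp (-(m * s)))
    (fun x _ => ?_) (Continuous.intervalIntegrable (by fun_prop) _ _)]
  · ring
  · have h1 : HasDerivAt (fun s => -(m * s)) (-m) x := by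
      simpa using ((hasDerivAt_id x).const_mul m).fun_neg
    convert! h1.exp.fun_neg using 1
    ring

lemma existsUnique_isPosRoot {ℓ m : ℝ} (hℓ : 0 < ℓ) (hm : 0 < m) :
    ∃! γ : ℝ, IsPosRoot ℓ m γ := by
  have h0 : renewalIntegral ℓ m 0 < 1 := by
    have : renewalIntegral ℓ m 0 = 1 - Real.exp (-(m * ℓ)) := by
      have := integral_mul_exp_neg m 0 ℓ
      simp only [mul_zero, neg_zero, Real.exp_zero] at this
      rw [← this, renewalIntegral]
      simp only [zero_sub, neg_mul]
    rw [this]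
    linarith [Real.exp_pos (-(m * ℓ))]
  -- Since `exp x ≥ x`, the integral is at least `m (g - m) ℓ² / 2`, which this `g` makes equal to
  -- `1`.
  set g := m + 2 / (m * ℓ ^ 2) with hg
  have h1 : 1 ≤ renewalIntegral ℓ m g := by
    have : (1 : ℝ) = ∫ s in (0 : ℝ)..ℓ, m * ((g - m) * s) := by
      rw [intervalIntegral.integral_const_mul, intervalIntegral.integral_const_mul, integral_id, hg]
      field_simp
      ring
    rw [this]
    refine intervalIntegral.integral_mono_on hℓ.le
      (Continuous.intervalIntegrable (by fun_prop) _ _)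
      (Continuous.intervalIntegrable (by fun_prop) _ _) fun s _ => ?_
    gcongr
    linarith [Real.add_one_le_exp ((g - m) * s)]
  have hg0 : 0 ≤ g := by positivity
  obtain ⟨γ, hγ, h⟩ := intermediate_value_Icc hg0
    (continuous_renewalIntegral_right ℓ m).continuousOn ⟨h0.le, h1⟩
  have hγ0 : γ ≠ 0 := by rintro rfl; exact h0.ne h
  refine ⟨γ, ⟨lt_of_le_of_ne hγ.1 hγ0.symm, h.symm⟩, fun y hy => ?_⟩
  exact (strictMono_renewalIntegral hℓ hm).injective (hy.2.symm.trans h.symm)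

/-- The harmonic function of the chain of runs of empty cells, for cells of length `δ`, intensity
`m` and decay rate `g`. -/
noncomputable def runPotential (m g δ : ℝ) (r j : ℕ) : ℝ :=
  ∑ i ∈ Finset.range (r - j),
    (1 - Real.exp (-(m * δ))) * Real.exp (-(m * δ)) ^ i * Real.exp (g * δ) ^ (i + 1)

lemma runPotential_self (m g δ : ℝ) (r : ℕ) : runPotential m g δ r r = 0 := by
  simp [runPotential]

lemma runPotential_pos {m g δ : ℝ} (h : 0 < m * δ) {r j : ℕ} (hj : j < r) :
    0 < runPotential m g δ r j := by
  have : 0 < 1 - Real.exp (-(m * δ)) := by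
    rw [sub_pos, Real.exp_lt_one_iff]; linarith
  exact Finset.sum_pos (fun i _ => by positivity) ⟨0, Finset.mem_range.2 (by omega)⟩

/-- Splitting off the term `i = 0` gives the harmonic equation with `1` in place of the value at
`0`. So the comparison of `runPotential m g δ r 0` with `1` decides between a supersolution and a
subsolution. -/
lemma exp_neg_mul_runPotential (m g δ : ℝ) {r j : ℕ} (hj : j < r) :
    Real.exp (-(g * δ)) * runPotential m g δ r j =
      (1 - Real.exp (-(m * δ))) + Real.exp (-(m * δ)) * runPotential m g δ r (j + 1) := by
  have hr : r - j = (r - (j + 1)) + 1 := by omega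
  have he : Real.exp (-(g * δ)) * Real.exp (g * δ) = 1 := by rw [← Real.exp_add]; simp
  rw [runPotential, hr, Finset.sum_range_succ', mul_add, runPotential, Finset.mul_sum,
    Finset.mul_sum, add_comm]
  congr 1
  · simp only [pow_zero, mul_one, zero_add, pow_one]
    linear_combination (1 - Real.exp (-(m * δ))) * he
  · refine Finset.sum_congr rfl fun i _ => ?_
    linear_combination ((1 - Real.exp (-(m * δ))) * Real.exp (-(m * δ)) ^ (i + 1)
      * Real.exp (g * δ) ^ (i + 1)) * he

lemma runPotential_term_eq_integral (m g δ : ℝ) (i : ℕ) :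
    (1 - Real.exp (-(m * δ))) * Real.exp (-(m * δ)) ^ i * Real.exp (g * δ) ^ (i + 1) =
      ∫ s in ((i : ℝ) * δ)..((i + 1 : ℕ) * δ),
        m * Real.exp (-(m * s)) * Real.exp (g * ((i + 1) * δ)) := by
  rw [intervalIntegral.integral_mul_const, integral_mul_exp_neg, ← Real.exp_nat_mul,
    ← Real.exp_nat_mul, sub_mul, sub_mul, sub_mul, one_mul, ← Real.exp_add, ← Real.exp_add,
    ← Real.exp_add, ← Real.exp_add, ← Real.exp_add]
  push_cast
  ring_nf

lemma renewalIntegral_eq_sum (m g δ : ℝ) (r : ℕ) :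
    renewalIntegral (r * δ) m g = ∑ i ∈ Finset.range r,
      ∫ s in ((i : ℝ) * δ)..((i + 1 : ℕ) * δ), m * Real.exp ((g - m) * s) := by
  rw [intervalIntegral.sum_integral_adjacent_intervals (a := fun i : ℕ => (i : ℝ) * δ)
    (fun _ _ => Continuous.intervalIntegrable (by fun_prop) _ _)]
  simp [renewalIntegral]

/-- On each cell the sum replaces `exp (g s)` by its value at the right endpoint, which is larger,
and by a factor of at most `exp (g δ)`; the second half is the next lemma. -/
lemma renewalIntegral_le_runPotential {m g δ : ℝ} (hm : 0 ≤ m) (hg : 0 ≤ g) (hδ : 0 ≤ δ)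
    (r : ℕ) : renewalIntegral (r * δ) m g ≤ runPotential m g δ r 0 := by
  rw [renewalIntegral_eq_sum, runPotential, Nat.sub_zero]
  refine Finset.sum_le_sum fun i _ => ?_
  rw [runPotential_term_eq_integral]
  refine intervalIntegral.integral_mono_on (by gcongr; simp)
      (Continuous.intervalIntegrable (by fun_prop) _ _)
      (Continuous.intervalIntegrable (by fun_prop) _ _) fun s hs => ?_
  rw [mul_assoc, ← Real.exp_add]
  have := hs.2
  push_cast at this
  gcongr
  nlinarith

lemma runPotential_le_renewalIntegral {m g δ : ℝ} (hm : 0 ≤ m) (hg : 0 ≤ g) (hδ : 0 ≤ δ)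
    (r : ℕ) : runPotential m g δ r 0 ≤ Real.exp (g * δ) * renewalIntegral (r * δ) m g := by
  rw [renewalIntegral_eq_sum, runPotential, Nat.sub_zero, Finset.mul_sum]
  refine Finset.sum_le_sum fun i _ => ?_
  rw [runPotential_term_eq_integral, ← intervalIntegral.integral_const_mul]
  refine intervalIntegral.integral_mono_on (by gcongr; simp)
      (Continuous.intervalIntegrable (by fun_prop) _ _)
      (Continuous.intervalIntegrable (by fun_prop) _ _) fun s hs => ?_
  have h : Real.exp (g * δ) * (m * Real.exp ((g - m) * s)) =
      m * Real.exp (g * δ + (g - m) * s) := by rw [Real.exp_add]; ring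
  rw [mul_assoc, ← Real.exp_add, h]
  refine mul_le_mul_of_nonneg_left (Real.exp_le_exp.2 ?_) hm
  nlinarith [hs.1]

end Renewal

/-! ### The three asymptotic regimes -/

section Asymptotics

variable {Ω : Type*} [MeasurableSpace Ω] {P : Measure Ω} [IsProbabilityMeasure P]
  {N : Ω → Set ℝ} {μ : ℝ → ℝ} {ℓ : ℝ}

lemma tendsto_measureReal_occupied (hμ : ∀ t : ℝ, IntegrableOn μ (Set.Ioo 0 t))
    (hN : IsPoissonProcess P N (intensity μ)) {δ m : ℝ} (hδ : 0 < δ) (hm : 0 ≤ m)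
    (h : Tendsto μ atTop (𝓝 m)) :
    Tendsto (fun i => P.real (occupied N δ i)) atTop (𝓝 (1 - Real.exp (-(m * δ)))) := by
  simp_rw [fun i => measureReal_occupied hN (intensity_cell_ne_top hμ δ i)]
  exact ((Real.continuous_exp.tendsto _).comp (tendsto_intensity_cell hμ hδ hm h).neg).const_sub 1

lemma tendsto_measureReal_occupied_one (hμ : ∀ t : ℝ, IntegrableOn μ (Set.Ioo 0 t))
    (hN : IsPoissonProcess P N (intensity μ)) {δ : ℝ} (hδ : 0 < δ)
    (h : Tendsto μ atTop atTop) :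
    Tendsto (fun i => P.real (occupied N δ i)) atTop (𝓝 1) := by
  simp_rw [fun i => measureReal_occupied hN (intensity_cell_ne_top hμ δ i)]
  simpa using (Real.tendsto_exp_neg_atTop_nhds_zero.comp
    (tendsto_intensity_cell_atTop hμ hδ h)).const_sub 1

lemma tendsto_potential_step (hμ : ∀ t : ℝ, IntegrableOn μ (Set.Ioo 0 t))
    (hN : IsPoissonProcess P N (intensity μ)) {δ m : ℝ} (hδ : 0 < δ) (hm : 0 ≤ m)
    (h : Tendsto μ atTop (𝓝 m)) (x y : ℝ) :
    Tendsto (fun i => P.real (occupied N δ i) * x + (1 - P.real (occupied N δ i)) * y) atTop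
      (𝓝 ((1 - Real.exp (-(m * δ))) * x + Real.exp (-(m * δ)) * y)) := by
  have h1 := tendsto_measureReal_occupied hμ hN hδ hm h
  simpa using (h1.mul_const x).add ((h1.const_sub 1).mul_const y)

theorem exists_gapTail_le_exp_of_tendsto (hℓ : 0 < ℓ)
    (hμ : ∀ t : ℝ, IntegrableOn μ (Set.Ioo 0 t)) (hN : IsPoissonProcess P N (intensity μ))
    {m γ a : ℝ} (hm : 0 < m) (h : Tendsto μ atTop (𝓝 m)) (hγ : IsPosRoot ℓ m γ) (ha : 0 ≤ a)
    (haγ : a < γ) : ∃ C > 0, ∀ t ≥ 0, gapTail P N ℓ t ≤ C * Real.exp (-(a * t)) := by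
  obtain ⟨g, hag, hgγ⟩ := exists_between haγ
  have hI : renewalIntegral ℓ m g < 1 :=
    (strictMono_renewalIntegral hℓ hm hgγ).trans_eq hγ.2.symm
  have hlim : Tendsto (fun k : ℕ => Real.exp (g * (ℓ / k)) * renewalIntegral ℓ m g) atTop
      (𝓝 (renewalIntegral ℓ m g)) := by
    have := ((Real.continuous_exp.tendsto _).comp
      ((tendsto_const_div_atTop_nhds_zero_nat ℓ).const_mul g)).mul_const (renewalIntegral ℓ m g)
    simpa using this
  obtain ⟨k, hkI, hk⟩ := ((hlim.eventually_le_const hI).and (eventually_gt_atTop 0)).exists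
  have hk' : (0 : ℝ) < k := by exact_mod_cast hk
  have hδ : 0 < ℓ / k := by positivity
  have hkℓ : k * (ℓ / k) = ℓ := by field_simp
  have hg : 0 ≤ g := ha.trans hag.le
  have h0 : runPotential m g (ℓ / k) k 0 ≤ 1 := by
    refine (runPotential_le_renewalIntegral hm.le hg hδ.le k).trans ?_
    rwa [hkℓ]
  have := exists_gapTail_le_exp hμ hN hδ hk (h := runPotential m g (ℓ / k) k)
    (runPotential_self _ _ _ _) (fun j hj => runPotential_pos (by positivity) hj) ha (by
      have : ∀ᶠ n in atTop, ∀ j ∈ Finset.range k, P.real (occupied N (ℓ / k) n) *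
          runPotential m g (ℓ / k) k 0 + (1 - P.real (occupied N (ℓ / k) n)) *
          runPotential m g (ℓ / k) k (j + 1) ≤
            Real.exp (-(a * (ℓ / k))) * runPotential m g (ℓ / k) k j := by
        rw [eventually_all_finset]
        intro j hj
        -- The limiting inequality is strict because `a < g`, so it persists for all late cells.
        refine (tendsto_potential_step hμ hN hδ hm.le h _ _).eventually_le_const ?_
        have hp : 0 < runPotential m g (ℓ / k) k j :=
          runPotential_pos (by positivity) (Finset.mem_range.1 hj)
        have hq : 0 ≤ 1 - Real.exp (-(m * (ℓ / k))) := by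
          rw [sub_nonneg, Real.exp_le_one_iff]
          have : 0 < m * (ℓ / k) := by positivity
          linarith
        calc _ ≤ (1 - Real.exp (-(m * (ℓ / k)))) * 1 + Real.exp (-(m * (ℓ / k))) *
              runPotential m g (ℓ / k) k (j + 1) := by gcongr
          _ = Real.exp (-(g * (ℓ / k))) * runPotential m g (ℓ / k) k j := by
            rw [exp_neg_mul_runPotential _ _ _ (Finset.mem_range.1 hj), mul_one]
          _ < _ := by gcongr
      simpa using this)
  rwa [hkℓ] at this

theorem exists_exp_le_gapTail_of_tendsto (hℓ : 0 < ℓ)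
    (hμ : ∀ t : ℝ, IntegrableOn μ (Set.Ioo 0 t))
    (hμpos : ∀ᵐ t ∂(volume.restrict (Set.Ioi (0 : ℝ))), 0 < μ t)
    (hN : IsPoissonProcess P N (intensity μ))
    {m γ a : ℝ} (hm : 0 < m) (h : Tendsto μ atTop (𝓝 m)) (hγ : IsPosRoot ℓ m γ)
    (haγ : γ < a) : ∃ c > 0, ∀ t ≥ 0, c * Real.exp (-(a * t)) ≤ gapTail P N ℓ t := by
  obtain ⟨g, hgγ, hag⟩ := exists_between haγ
  have hI : 1 < renewalIntegral ℓ m g :=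
    hγ.2.trans_lt (strictMono_renewalIntegral hℓ hm hgγ)
  -- The lower bound has `r` cells of length `ℓ / (r + 1)`; the missing cell disappears in the
  -- limit.
  have hlim : Tendsto (fun r : ℕ => renewalIntegral (r * (ℓ / (r + 1))) m g) atTop
      (𝓝 (renewalIntegral ℓ m g)) := by
    refine ((continuous_renewalIntegral_left m g).tendsto ℓ).comp ?_
    have := (tendsto_natCast_div_add_atTop (1 : ℝ)).mul_const ℓ
    rw [one_mul] at this
    exact this.congr fun r => by ring
  obtain ⟨r, hrI, hr⟩ := ((hlim.eventually_const_le hI).and (eventually_gt_atTop 0)).exists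
  have hδ : 0 < ℓ / (r + 1) := by positivity
  have hrℓ : (r + 1) * (ℓ / (r + 1)) = ℓ := by field_simp
  have hg : 0 ≤ g := hγ.1.le.trans hgγ.le
  have h0 : 1 ≤ runPotential m g (ℓ / (r + 1)) r 0 :=
    hrI.trans (renewalIntegral_le_runPotential hm.le hg hδ.le r)
  have := exists_exp_le_gapTail hμ hμpos hN hδ hr (h := runPotential m g (ℓ / (r + 1)) r)
    (runPotential_self _ _ _ _) (fun j hj => runPotential_pos (by positivity) hj)
    (hg.trans hag.le) (by
      have : ∀ᶠ n in atTop, ∀ j ∈ Finset.range r,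
          Real.exp (-(a * (ℓ / (r + 1)))) * runPotential m g (ℓ / (r + 1)) r j ≤
          P.real (occupied N (ℓ / (r + 1)) n) *
          runPotential m g (ℓ / (r + 1)) r 0 + (1 - P.real (occupied N (ℓ / (r + 1)) n)) *
          runPotential m g (ℓ / (r + 1)) r (j + 1) := by
        rw [eventually_all_finset]
        intro j hj
        refine (tendsto_potential_step hμ hN hδ hm.le h _ _).eventually_const_le ?_
        have hp : 0 < runPotential m g (ℓ / (r + 1)) r j :=
          runPotential_pos (by positivity) (Finset.mem_range.1 hj)
        have hq : 0 ≤ 1 - Real.exp (-(m * (ℓ / (r + 1)))) := by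
          rw [sub_nonneg, Real.exp_le_one_iff]
          have : 0 < m * (ℓ / (r + 1)) := by positivity
          linarith
        calc _ < Real.exp (-(g * (ℓ / (r + 1)))) * runPotential m g (ℓ / (r + 1)) r j := by gcongr
          _ = (1 - Real.exp (-(m * (ℓ / (r + 1))))) * 1 + Real.exp (-(m * (ℓ / (r + 1)))) *
              runPotential m g (ℓ / (r + 1)) r (j + 1) := by
            rw [exp_neg_mul_runPotential _ _ _ (Finset.mem_range.1 hj), mul_one]
          _ ≤ _ := by gcongr
      simpa using this)
  rwa [hrℓ] at this

theorem logAsymp_gapTail (hℓ : 0 < ℓ)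
    (hμ : ∀ t : ℝ, IntegrableOn μ (Set.Ioo 0 t))
    (hμpos : ∀ᵐ t ∂(volume.restrict (Set.Ioi (0 : ℝ))), 0 < μ t)
    (hN : IsPoissonProcess P N (intensity μ))
    {m γ : ℝ} (hm : 0 < m) (h : Tendsto μ atTop (𝓝 m)) (hγ : IsPosRoot ℓ m γ) :
    LogAsymp (fun t => gapTail P N ℓ t) (fun t => Real.exp (-γ * t)) := by
  have hf := gapTail_pos hμ hμpos hN hℓ
  have hγ0 := hγ.1
  have key : Tendsto (fun t => -Real.log (gapTail P N ℓ t) / t) atTop (𝓝 γ) := by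
    rw [tendsto_order]
    constructor
    · intro b hb
      -- The upper bound requires a nonnegative rate, whereas `b` may be negative.
      obtain ⟨a, ha, haγ⟩ := exists_between (max_lt hb hγ0)
      obtain ⟨b', hb', hba⟩ := exists_between ((le_max_left _ _).trans_lt ha)
      filter_upwards [eventually_le_neg_log_div hf hba (exists_gapTail_le_exp_of_tendsto hℓ hμ hN
        hm h hγ ((le_max_right b 0).trans ha.le) haγ)] with t ht
      exact hb'.trans_le ht
    · intro b hb
      obtain ⟨a, haγ, ha⟩ := exists_between hb
      obtain ⟨b', hb', hba⟩ := exists_between ha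
      filter_upwards [eventually_neg_log_div_le hb' (exists_exp_le_gapTail_of_tendsto hℓ hμ
        hμpos hN hm h hγ haγ)] with t ht
      exact ht.trans_lt hba
  have := key.div_const γ
  rw [div_self hγ0.ne'] at this
  refine this.congr' ?_
  filter_upwards [eventually_gt_atTop 0] with t ht
  rw [Real.log_exp]
  field_simp

theorem tendsto_neg_log_gapTail_div_nhds_zero (hℓ : 0 < ℓ)
    (hμ : ∀ t : ℝ, IntegrableOn μ (Set.Ioo 0 t))
    (hμpos : ∀ᵐ t ∂(volume.restrict (Set.Ioi (0 : ℝ))), 0 < μ t)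
    (hN : IsPoissonProcess P N (intensity μ)) (h : Tendsto μ atTop atTop) :
    Tendsto (fun t => -Real.log (gapTail P N ℓ t) / t) atTop (𝓝 0) := by
  have hf := gapTail_pos hμ hμpos hN hℓ
  have hδ : 0 < ℓ / 2 := by positivity
  have hlow : ∀ a > 0, ∃ c > 0, ∀ t ≥ 0, c * Real.exp (-(a * t)) ≤ gapTail P N ℓ t := by
    intro a ha
    -- With `r = 1` the only live state is `0`, and the condition reduces to `exp (-(a δ)) ≤ P.real
    -- (occupied N δ n)`.
    have := exists_exp_le_gapTail hμ hμpos hN hδ one_pos (h := fun j => if j = 0 then 1 else 0)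
      (by simp) (by simp) ha.le (by
        have ha' : Real.exp (-(a * (ℓ / 2))) < 1 := by
          rw [Real.exp_lt_one_iff]
          have : 0 < a * (ℓ / 2) := by positivity
          linarith
        filter_upwards [(tendsto_measureReal_occupied_one hμ hN hδ h).eventually_const_le ha']
          with n hn
        simpa using hn)
    rwa [show ((1 : ℕ) + 1 : ℝ) * (ℓ / 2) = ℓ by push_cast; ring] at this
  rw [tendsto_order]
  constructor
  · intro b hb
    filter_upwards [eventually_gt_atTop 0] with t ht
    have := Real.log_nonpos (hf t).le measureReal_le_one
    exact hb.trans_le (div_nonneg (by linarith) ht.le)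
  · intro b hb
    obtain ⟨b', hb', hbb⟩ := exists_between hb
    obtain ⟨a, ha, hab⟩ := exists_between hb'
    filter_upwards [eventually_neg_log_div_le hab (hlow a ha)] with t ht
    exact ht.trans_lt hbb

theorem tendsto_neg_log_gapTail_div_atTop (hℓ : 0 < ℓ)
    (hμ : ∀ t : ℝ, IntegrableOn μ (Set.Ioo 0 t))
    (hμpos : ∀ᵐ t ∂(volume.restrict (Set.Ioi (0 : ℝ))), 0 < μ t)
    (hN : IsPoissonProcess P N (intensity μ)) (h : Tendsto μ atTop (𝓝 0)) :
    Tendsto (fun t => -Real.log (gapTail P N ℓ t) / t) atTop atTop := by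
  have hf := gapTail_pos hμ hμpos hN hℓ
  rw [tendsto_atTop]
  intro b
  have hb : b < max b 0 + 1 := (le_max_left b 0).trans_lt (lt_add_one _)
  refine eventually_le_neg_log_div hf hb ?_
  have := exists_gapTail_le_exp hμ hN hℓ one_pos (h := fun j => if j = 0 then 1 else 0)
    (by simp) (by simp) (a := max b 0 + 1) (by positivity) (by
      have h0 := tendsto_measureReal_occupied hμ hN hℓ le_rfl h
      simp only [zero_mul, neg_zero, Real.exp_zero, sub_self] at h0
      filter_upwards [h0.eventually_le_const (Real.exp_pos (-((max b 0 + 1) * ℓ)))] with n hn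
      simpa using hn)
  simpa using this

end Asymptotics

theorem mainTheorem9 {Ω : Type*} [MeasurableSpace Ω] (P : Measure Ω) [IsProbabilityMeasure P]
    (ℓ : ℝ) (hℓ : 0 < ℓ) (μ : ℝ → ℝ)
    (hμ_int : ∀ t : ℝ, IntegrableOn μ (Set.Ioo 0 t))
    (hμ_pos : ∀ᵐ t ∂(volume.restrict (Set.Ioi (0 : ℝ))), 0 < μ t)
    (N : Ω → Set ℝ) (hN : IsPoissonProcess P N (intensity μ)) :
    (∀ t : ℝ, 0 < gapTail P N ℓ t) ∧
    (∀ m : ℝ, 0 < m → Tendsto μ atTop (𝓝 m) →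
      (∃! γ : ℝ, IsPosRoot ℓ m γ) ∧
      ∀ γ : ℝ, IsPosRoot ℓ m γ →
        LogAsymp (fun t => gapTail P N ℓ t) (fun t => Real.exp (-γ * t))) ∧
    (Tendsto μ atTop atTop →
      Tendsto (fun t => -Real.log (gapTail P N ℓ t) / t) atTop (𝓝 0)) ∧
    (Tendsto μ atTop (𝓝 0) →
      Tendsto (fun t => -Real.log (gapTail P N ℓ t) / t) atTop atTop) :=
  ⟨gapTail_pos hμ_int hμ_pos hN hℓ,
    fun _ hm h => ⟨existsUnique_isPosRoot hℓ hm,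
      fun _ hγ => logAsymp_gapTail hℓ hμ_int hμ_pos hN hm h hγ⟩,
    tendsto_neg_log_gapTail_div_nhds_zero hℓ hμ_int hμ_pos hN,
    tendsto_neg_log_gapTail_div_atTop hℓ hμ_int hμ_pos hN⟩
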